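/- Let $M$ be a closed (compact, without boundary) smooth manifold of dimension $n\ge 1$ with a smooth Riemannian metric, and let $d$ be any metric on $M$ that induces its topology. Let $f\colon M\to M$ be a $C^1$ local diffeomorphism, i.e. $f$ is surjective and every point of $M$ has an open neighbourhood that $f$ maps $C^1$-diffeomorphically onto an open set. Write $\|D_xf\|_{\mathrm{co}}=\min\{\|(D_xf)v\| : v\in T_xM,\ \|v\|=1\}$. For $\lambda>0$ and an integer $m\ge 1$, the orbit string $(x,f(x),\dots,f^m(x))$ of length $m$ is called $\lambda$-quasi-expanding if $$\frac1\ell\sum_{j=1}^{\ell}\log\|D_{f^{m-j}(x)}f\|_{\mathrm{co}}\ge\lambda\qquad\text{for all }\ell=1,\dots,m.$$ Then for all $\varepsilon>0$ and $\lambda>0$ there exists $\delta>0$ such that the following holds. Let $k\ge 0$, let $x_0,\dots,x_k\in M$ and let $n_0,\dots,n_k\ge1$ be integers such that each string $(x_i,f(x_i),\dots,f^{n_i}(x_i))$, $0\le i\le k$, is $\lambda$-quasi-expanding and $d(f^{n_i}(x_i),x_{i+1})<\delta$ for all $0\le i\le k$, where $x_{k+1}=x_0$. Then there is a point $p\in M$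 with $f^{\tau}(p)=p$, where $\tau=n_0+\cdots+n_k$ (not necessarily the minimal period), such that $$d\bigl(f^{\,n_0+\cdots+n_{i-1}+j}(p),\,f^j(x_i)\bigr)<\varepsilon\qquad\text{for all }0\le i\le k,\ 0\le j\le n_i$$ (the sum $n_0+\cdots+n_{i-1}$ being $0$ for $i=0$), and $$\frac1\ell\sum_{j=1}^{\ell}\log\|D_{f^{\tau-j}(p)}f\|_{\mathrm{co}}\ge\lambda-\varepsilon\qquad\text{for all }\ell=1,\dots,\tau.$$ -/

import Mathlib

open scoped Manifold ContDiff Bundle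

noncomputable section

/-- `f` is a `C^1` local diffeomorphism of `M`: it is surjective, and around every point it restricts
to a `C^1` diffeomorphism between open sets. -/
def IsC1LocalDiffeo {n : ℕ} {M : Type*} [TopologicalSpace M]
    [ChartedSpace (EuclideanSpace ℝ (Fin n)) M] (f : M → M) : Prop :=
  Function.Surjective f ∧ IsLocalDiffeomorph (𝓡 n) (𝓡 n) 1 f

/-- The co-norm `‖D_x f‖_co`, the minimum of `‖(D_x f) v‖` over the unit tangent vectors `v` at `x`,
for the norms given by the Riemannian metric. -/
def derivConorm {n : ℕ} {M : Type*} [TopologicalSpace M]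
    [ChartedSpace (EuclideanSpace ℝ (Fin n)) M]
    [Bundle.RiemannianBundle (fun x : M ↦ TangentSpace (𝓡 n) x)] (f : M → M) (x : M) : ℝ :=
  sInf {r : ℝ | ∃ v : TangentSpace (𝓡 n) x, ‖v‖ = 1 ∧ r = ‖mfderiv (𝓡 n) (𝓡 n) f x v‖}

/-- The average of `log ‖Df‖_co` over the points `f^{k-1}(x), …, f^{k-ℓ}(x)`, where `1 ≤ ℓ ≤ k`. -/
def backwardAverage {n : ℕ} {M : Type*} [TopologicalSpace M]
    [ChartedSpace (EuclideanSpace ℝ (Fin n)) M]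
    [Bundle.RiemannianBundle (fun x : M ↦ TangentSpace (𝓡 n) x)]
    (f : M → M) (x : M) (k ℓ : ℕ) : ℝ :=
  (1 / (ℓ : ℝ)) * ∑ j ∈ Finset.Icc 1 ℓ, Real.log (derivConorm (n := n) f (f^[k - j] x))

/-- The orbit string `(x, f(x), …, f^k(x))`, of length `k ≥ 1`, is `lam`-quasi-expanding. -/
def IsQuasiExpandingString {n : ℕ} {M : Type*} [TopologicalSpace M]
    [ChartedSpace (EuclideanSpace ℝ (Fin n)) M]
    [Bundle.RiemannianBundle (fun x : M ↦ TangentSpace (𝓡 n) x)]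
    (f : M → M) (lam : ℝ) (x : M) (k : ℕ) : Prop :=
  1 ≤ k ∧ ∀ ℓ : ℕ, 1 ≤ ℓ → ℓ ≤ k → lam ≤ backwardAverage (n := n) f x k ℓ

end

/-!
Let `φ x = log ‖D_x f‖_co` and `exp (-lam) < θ < 1`. For the distance of the Riemannian metric, all
points `x` have inverse branches of `f` on a ball of uniform radius about `f x`, with Lipschitz
constant `K x = θ exp (lam - φ x)`. Quasi-expansion says that the sums of `φ - lam` over the final
pieces of a string are nonnegative, so the products of `K` over these pieces are at most `1`.
Pulling the ball at the end of the string back along the orbit therefore never enlarges it, and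
over the whole string contracts it by `θ`. If the jumps are small, the pullbacks along the strings,
taken in cyclic order, form a contraction of a product of balls, and its fixed point is the
shadowing periodic orbit. As `φ` is uniformly continuous, the tail sums of `φ - (lam - ε)` stay
nonnegative along each piece of that orbit, and this property is preserved by concatenation.
-/

open Bundle Filter Set
open Metric (closedEBall)
open scoped Topology NNReal ENNReal

section TailSums

/-- Every tail `u a + ⋯ + u (k - 1)` of the finite sequence `u 0, …, u (k - 1)` is nonnegative. With
`u t = log ‖D_{f^t(x)} f‖_co - c` this says that the string of length `k` starting at `x` is
`c`-quasi-expanding. -/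
def NonnegTailSums (u : ℕ → ℝ) (k : ℕ) : Prop :=
  ∀ a, 0 ≤ ∑ t ∈ Finset.Ico a k, u t

variable {u v : ℕ → ℝ} {k l : ℕ}

theorem NonnegTailSums.mono (hu : NonnegTailSums u k) (huv : ∀ t < k, u t ≤ v t) :
    NonnegTailSums v k := fun a ↦
  (hu a).trans <| Finset.sum_le_sum fun t ht ↦ huv t (Finset.mem_Ico.1 ht).2

theorem NonnegTailSums.append (hu : NonnegTailSums u k)
    (hv : NonnegTailSums (fun t ↦ u (k + t)) l) : NonnegTailSums u (k + l) := fun a ↦ by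
  rcases le_total a k with hak | hka
  · rw [← Finset.sum_Ico_consecutive u hak (Nat.le_add_right k l)]
    refine add_nonneg (hu a) ?_
    have := hv 0
    rwa [Finset.sum_Ico_add u 0 l k, zero_add, add_comm l] at this
  · obtain ⟨b, rfl⟩ := Nat.exists_eq_add_of_le hka
    have := hv b
    rwa [Finset.sum_Ico_add u b l k, add_comm b, add_comm l] at this

theorem NonnegTailSums.concat {len : ℕ → ℕ} (m : ℕ)
    (h : ∀ i < m, NonnegTailSums (fun t ↦ u ((∑ i' ∈ Finset.range i, len i') + t)) (len i)) :
    NonnegTailSums u (∑ i ∈ Finset.range m, len i) := by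
  induction m with
  | zero => simp [NonnegTailSums]
  | succ m ih =>
    rw [Finset.sum_range_succ]
    exact (ih fun i hi ↦ h i (hi.trans m.lt_succ_self)).append (h m m.lt_succ_self)

theorem NonnegTailSums.prod_mul_exp_neg_le (hu : NonnegTailSums u k) (θ : ℝ≥0) (a : ℕ) :
    ∏ t ∈ Finset.Ico a k, θ * (Real.exp (-u t)).toNNReal ≤ θ ^ (k - a) := by
  have hexp : ∏ t ∈ Finset.Ico a k, (Real.exp (-u t)).toNNReal ≤ 1 := by
    rw [← Real.toNNReal_prod_of_nonneg fun t _ ↦ (Real.exp_pos _).le, ← Real.exp_sum,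
      Finset.sum_neg_distrib, Real.toNNReal_le_one, Real.exp_le_one_iff]
    exact neg_nonpos.2 (hu a)
  rw [Finset.prod_mul_distrib, Finset.prod_const, Nat.card_Ico]
  exact mul_le_of_le_one_right' hexp

end TailSums

section InverseBranches

variable {X Y Z : Type*} [PseudoEMetricSpace X] [PseudoEMetricSpace Y] [PseudoEMetricSpace Z]

/-- `g` is an inverse branch of `F` at `x`: on the closed ball of radius `r` around `F x`, it is a
`K`-Lipschitz right inverse of `F`, and it maps `F x` back to `x`. -/
structure IsInverseBranchAt (F : X → Y) (x : X) (r : ℝ≥0∞) (K : ℝ≥0) (g : Y → X) : Prop where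
  map_center : g (F x) = x
  rightInvOn : RightInvOn g F (closedEBall (F x) r)
  lipschitzOnWith : LipschitzOnWith K g (closedEBall (F x) r)

/-- `f` has inverse branches of a uniform size `r` at all points, with a Lipschitz constant `K x`
that may depend on the point `x`. -/
def HasInverseBranches (f : X → Y) (r : ℝ≥0∞) (K : X → ℝ≥0) : Prop :=
  ∀ x, ∃ g, IsInverseBranchAt f x r (K x) g

namespace IsInverseBranchAt

variable {F : X → Y} {F' : Y → Z} {x : X} {r r' : ℝ≥0∞} {K K' : ℝ≥0} {g : Y → X} {g' : Z → Y}

theorem id (x : X) (r : ℝ≥0∞) : IsInverseBranchAt id x r 1 id where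
  map_center := rfl
  rightInvOn _ _ := rfl
  lipschitzOnWith := LipschitzWith.id.lipschitzOnWith

theorem mono (hg : IsInverseBranchAt F x r K g) (hr : r' ≤ r) (hK : K ≤ K') :
    IsInverseBranchAt F x r' K' g where
  map_center := hg.map_center
  rightInvOn := hg.rightInvOn.mono (Metric.closedEBall_subset_closedEBall hr)
  lipschitzOnWith :=
    (hg.lipschitzOnWith.mono (Metric.closedEBall_subset_closedEBall hr)).weaken hK

theorem mapsTo (hg : IsInverseBranchAt F x r K g) :
    MapsTo g (closedEBall (F x) r) (closedEBall x (K * r)) := fun y hy ↦ by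
  have h := hg.lipschitzOnWith hy (Metric.mem_closedEBall_self (x := F x) (ε := r))
  rw [hg.map_center] at h
  exact h.trans (mul_le_mul_right hy _)

theorem mapsTo_of_le_one (hg : IsInverseBranchAt F x r K g) (hK : K ≤ 1) :
    MapsTo g (closedEBall (F x) r) (closedEBall x r) :=
  hg.mapsTo.mono_right <| Metric.closedEBall_subset_closedEBall <|
    mul_le_of_le_one_left' (by exact_mod_cast hK)

theorem comp (hg' : IsInverseBranchAt F' (F x) r K' g') (hg : IsInverseBranchAt F x r K g)
    (hK' : K' ≤ 1) : IsInverseBranchAt (F' ∘ F) x r (K * K') (g ∘ g') where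
  map_center := by simp [hg'.map_center, hg.map_center]
  rightInvOn y hy := by
    simp [hg.rightInvOn (hg'.mapsTo_of_le_one hK' hy), hg'.rightInvOn hy]
  lipschitzOnWith :=
    hg.lipschitzOnWith.comp hg'.lipschitzOnWith (hg'.mapsTo_of_le_one hK')

end IsInverseBranchAt

theorem HasInverseBranches.mono {f : X → Y} {r r' : ℝ≥0∞} {K : X → ℝ≥0}
    (hf : HasInverseBranches f r K) (hr : r' ≤ r) : HasInverseBranches f r' K := fun x ↦
  (hf x).imp fun _ hg ↦ hg.mono hr le_rfl

theorem exists_eventually_isInverseBranchAt {F : X → Y} {g : Y → X} {x₀ : X} {s : Set Y} {K : ℝ≥0}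
    (hF : ContinuousAt F x₀) (hgF : ∀ᶠ x in 𝓝 x₀, g (F x) = x) (hs : s ∈ 𝓝 (F x₀))
    (hFg : RightInvOn g F s) (hg : LipschitzOnWith K g s) :
    ∃ r > 0, ∀ᶠ x in 𝓝 x₀, IsInverseBranchAt F x r K g := by
  obtain ⟨ρ, hρ, hρs⟩ := Metric.nhds_basis_closedEBall.mem_iff.1 hs
  refine ⟨ρ / 2, ENNReal.half_pos hρ.ne', ?_⟩
  filter_upwards [hgF, hF (Metric.closedEBall_mem_nhds (F x₀) (ENNReal.half_pos hρ.ne'))]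
    with x hx hFx
  have hball : closedEBall (F x) (ρ / 2) ⊆ s := fun y hy ↦ hρs <|
    (edist_triangle y (F x) (F x₀)).trans <| (add_le_add hy hFx).trans_eq (ENNReal.add_halves ρ)
  exact ⟨hx, hFg.mono hball, hg.mono hball⟩

theorem exists_hasInverseBranches_of_locally [CompactSpace X] {f : X → Y} {K : X → ℝ≥0}
    (h : ∀ x₀, ∃ r > 0, ∀ᶠ x in 𝓝 x₀, ∃ g, IsInverseBranchAt f x r (K x) g) :
    ∃ r > 0, HasInverseBranches f r K := by
  choose r hr hrx using h
  obtain ⟨t, ht⟩ := CompactSpace.elim_nhds_subcover _ hrx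
  refine ⟨t.inf r, (Finset.lt_inf_iff (by simp)).2 fun x₀ _ ↦ hr x₀, fun x ↦ ?_⟩
  obtain ⟨x₀, hx₀, hx⟩ := mem_iUnion₂.1 (ht.ge (mem_univ x))
  obtain ⟨g, hg⟩ := hx
  exact ⟨g, hg.mono (Finset.inf_le hx₀) le_rfl⟩

theorem HasInverseBranches.exists_iterate {f : X → X} {r : ℝ≥0∞} {K : X → ℝ≥0}
    (hf : HasInverseBranches f r K) (m : ℕ) (x : X)
    (hK : ∀ a, ∏ t ∈ Finset.Ico a m, K (f^[t] x) ≤ 1) :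
    ∃ g, IsInverseBranchAt f^[m] x r (∏ t ∈ Finset.range m, K (f^[t] x)) g ∧
      ∀ j ≤ m, MapsTo (f^[j] ∘ g) (closedEBall (f^[m] x) r) (closedEBall (f^[j] x) r) := by
  induction m generalizing x with
  | zero =>
    refine ⟨id, by simpa using IsInverseBranchAt.id x r, fun j hj ↦ ?_⟩
    obtain rfl := Nat.le_zero.1 hj
    exact mapsTo_id _
  | succ m ih =>
    have hK_tail (a : ℕ) : ∏ t ∈ Finset.Ico a m, K (f^[t] (f x)) ≤ 1 := by
      have := hK (a + 1)
      rwa [← Finset.prod_Ico_add' (fun t ↦ K (f^[t] x))] at this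
    obtain ⟨g', hg', hg'_orbit⟩ := ih (f x) hK_tail
    obtain ⟨g, hg⟩ := hf x
    have hcomp : IsInverseBranchAt f^[m + 1] x r (∏ t ∈ Finset.range (m + 1), K (f^[t] x))
        (g ∘ g') := by
      rw [Finset.prod_range_succ', mul_comm]
      exact hg'.comp hg (by simpa using hK_tail 0)
    refine ⟨g ∘ g', hcomp, fun j hj y hy ↦ ?_⟩
    cases j with
    | zero => exact hcomp.mapsTo_of_le_one (by simpa using hK 0) hy
    | succ j =>
      have hgg' : f (g (g' y)) = g' y := hg.rightInvOn (hg'_orbit 0 m.zero_le hy)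
      simpa [hgg'] using hg'_orbit j (Nat.le_of_succ_le_succ hj) hy

end InverseBranches

section Shadowing

theorem exists_forall_apply_eq_of_lipschitzOnWith {ι X : Type*} [Finite ι] [EMetricSpace X]
    [CompleteSpace X] {θ : ℝ≥0} (hθ : θ < 1) {r : ℝ≥0∞} (hr : r ≠ ⊤) (σ : ι → ι) (c : ι → X)
    (g : ι → X → X) (hg : ∀ i, LipschitzOnWith θ (g i) (closedEBall (c i) r))
    (hmaps : ∀ i, MapsTo (g (σ i)) (closedEBall (c (σ i)) r) (closedEBall (c i) r)) :
    ∃ y : ι → X, (∀ i, y i ∈ closedEBall (c i) r) ∧ ∀ i, g (σ i) (y (σ i)) = y i := by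
  have := Fintype.ofFinite ι
  set s : Set (ι → X) := univ.pi fun i ↦ closedEBall (c i) r
  let T (y : ι → X) (i : ι) : X := g (σ i) (y (σ i))
  have hTs : MapsTo T s s := fun y hy i _ ↦ hmaps i (hy (σ i) trivial)
  have hT : ContractingWith θ (hTs.restrict T s s) := by
    refine ⟨hθ, fun y z ↦ edist_pi_le_iff.2 fun i ↦ ?_⟩
    exact (hg (σ i) (y.2 (σ i) trivial) (z.2 (σ i) trivial)).trans
      (mul_le_mul_right (edist_le_pi_edist _ _ (σ i)) _)
  have hs : IsClosed s := isClosed_set_pi fun i _ ↦ Metric.isClosed_closedEBall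
  have hc : c ∈ s := fun i _ ↦ Metric.mem_closedEBall_self
  have hcT : edist c (T c) ≠ ⊤ := ne_top_of_le_ne_top hr <| edist_pi_le_iff.2 fun i ↦ by
    rw [edist_comm]
    exact hTs hc i trivial
  obtain ⟨y, hys, hy, -⟩ := hT.exists_fixedPoint' hs.isComplete hTs hc hcT
  exact ⟨y, fun i ↦ hys i trivial, congrFun hy⟩

theorem iterate_sum_range_apply {X : Type*} {f : X → X} {z : ℕ → X} {len : ℕ → ℕ} {m : ℕ}
    (hz : ∀ i < m, f^[len i] (z i) = z (i + 1)) :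
    f^[∑ i ∈ Finset.range m, len i] (z 0) = z m := by
  induction m with
  | zero => rfl
  | succ m ih =>
    rw [Finset.sum_range_succ, add_comm, Function.iterate_add_apply,
      ih fun i hi ↦ hz i (hi.trans m.lt_succ_self), hz m m.lt_succ_self]

theorem exists_cycle_of_isInverseBranchAt {X : Type*} [EMetricSpace X] [CompleteSpace X]
    {F g : ℕ → X → X} {x : ℕ → X} {k : ℕ} {r δ : ℝ≥0∞} {θ : ℝ≥0} (hr : r ≠ ⊤) (hθ : θ < 1)
    (hδ : θ * r + δ ≤ r) (hg : ∀ i ≤ k, IsInverseBranchAt (F i) (x i) r θ (g i))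
    (hx : x (k + 1) = x 0) (hjump : ∀ i ≤ k, edist (F i (x i)) (x (i + 1)) ≤ δ) :
    ∃ z : ℕ → X, z (k + 1) = z 0 ∧
      ∀ i ≤ k, F i (z i) = z (i + 1) ∧ z i ∈ g i '' closedEBall (F i (x i)) r := by
  have hx_succ (i : Fin (k + 1)) : x ((i + 1 : Fin (k + 1)) : ℕ) = x (i + 1) := by
    cases i using Fin.lastCases with
    | last => simp [hx]
    | cast i => simp
  have hg' (i : Fin (k + 1)) := hg i i.is_le
  have hmaps (i : Fin (k + 1)) : MapsTo (g (i + 1 : Fin (k + 1)))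
      (closedEBall (F (i + 1 : Fin (k + 1)) (x (i + 1 : Fin (k + 1)))) r)
      (closedEBall (F i (x i)) r) := fun y hy ↦ by
    have hy' := (hg' (i + 1)).mapsTo hy
    rw [hx_succ] at hy'
    refine (edist_triangle_right _ _ (x (i + 1))).trans <| (add_le_add hy' ?_).trans hδ
    exact hjump i i.is_le
  obtain ⟨y, hy_mem, hy⟩ := exists_forall_apply_eq_of_lipschitzOnWith hθ hr
    (fun i : Fin (k + 1) ↦ i + 1) (fun i ↦ F i (x i)) (fun i ↦ g i)
    (fun i ↦ (hg' i).lipschitzOnWith) hmaps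
  -- `Fin.ofNat (k + 1)` reduces its argument modulo `k + 1`
  refine ⟨fun i ↦ g (Fin.ofNat (k + 1) i) (y (Fin.ofNat (k + 1) i)), by simp, fun i hi ↦ ?_⟩
  have hval : (Fin.ofNat (k + 1) i : ℕ) = i := Nat.mod_eq_of_lt (Nat.lt_succ_of_le hi)
  have hsucc : Fin.ofNat (k + 1) (i + 1) = Fin.ofNat (k + 1) i + 1 := by
    ext
    simp [Fin.val_add]
  have hyi := hy_mem (Fin.ofNat (k + 1) i)
  rw [hval] at hyi
  refine ⟨?_, ?_⟩
  · simp only [hsucc, hy, hval]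
    exact (hg i hi).rightInvOn hyi
  · simp only [hval]
    exact mem_image_of_mem _ hyi

theorem HasInverseBranches.exists_isPeriodicPt_shadowing {X : Type*} [EMetricSpace X]
    [CompleteSpace X] {f : X → X} {K : X → ℝ≥0} {x : ℕ → X} {len : ℕ → ℕ} {k : ℕ} {r δ : ℝ≥0∞}
    {θ : ℝ≥0} (hf : HasInverseBranches f r K) (hr : r ≠ ⊤) (hθ : θ < 1) (hδ : θ * r + δ ≤ r)
    (hK : ∀ i ≤ k, ∀ a, ∏ t ∈ Finset.Ico a (len i), K (f^[t] (x i)) ≤ 1)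
    (hKθ : ∀ i ≤ k, ∏ t ∈ Finset.range (len i), K (f^[t] (x i)) ≤ θ)
    (hx : x (k + 1) = x 0) (hjump : ∀ i ≤ k, edist (f^[len i] (x i)) (x (i + 1)) ≤ δ) :
    ∃ p, Function.IsPeriodicPt f (∑ i ∈ Finset.range (k + 1), len i) p ∧
      ∀ i ≤ k, ∀ j ≤ len i,
        edist (f^[(∑ m ∈ Finset.range i, len m) + j] p) (f^[j] (x i)) ≤ r := by
  have : Nonempty X := ⟨x 0⟩
  choose! g hg hg_orbit using fun i hi ↦ hf.exists_iterate (len i) (x i) (hK i hi)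
  obtain ⟨z, hz_cycle, hz⟩ := exists_cycle_of_isInverseBranchAt hr hθ hδ
    (fun i hi ↦ (hg i hi).mono le_rfl (hKθ i hi)) hx hjump
  have hz_iter {i : ℕ} (hi : i ≤ k + 1) : f^[∑ m ∈ Finset.range i, len m] (z 0) = z i :=
    iterate_sum_range_apply fun m hm ↦ (hz m (by lia)).1
  refine ⟨z 0, (hz_iter le_rfl).trans hz_cycle, fun i hi j hj ↦ ?_⟩
  obtain ⟨y, hy, hyz⟩ := (hz i hi).2
  rw [add_comm, Function.iterate_add_apply, hz_iter (by lia), ← hyz]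
  exact hg_orbit i hi j hj hy

end Shadowing

section Conorm

variable {V E F : Type*} [NormedAddCommGroup V] [NormedSpace ℝ V] [NormedAddCommGroup E]
  [NormedSpace ℝ E] [NormedAddCommGroup F] [NormedSpace ℝ F]

/-- The co-norm of a linear map, the infimum of `‖A v‖` over the unit vectors `v`; it is `0` if
there are no unit vectors. By definition, `derivConorm f x` is the co-norm of `D_x f`. -/
noncomputable def conorm (A : E →ₗ[ℝ] F) : ℝ :=
  sInf {r : ℝ | ∃ v, ‖v‖ = 1 ∧ r = ‖A v‖}

theorem conorm_eq_sInf_image_sphere (A : E →ₗ[ℝ] F) :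
    conorm A = sInf ((fun v ↦ ‖A v‖) '' Metric.sphere 0 1) := by
  simp only [conorm, image, mem_sphere_zero_iff_norm, eq_comm]

theorem conorm_mul_norm_le (A : E →ₗ[ℝ] F) (v : E) : conorm A * ‖v‖ ≤ ‖A v‖ := by
  rcases eq_or_ne v 0 with rfl | hv
  · simp
  have h : conorm A ≤ ‖A (‖v‖⁻¹ • v)‖ :=
    csInf_le ⟨0, fun _ ⟨_, _, hr⟩ ↦ hr ▸ norm_nonneg _⟩
      ⟨‖v‖⁻¹ • v, norm_smul_inv_norm (𝕜 := ℝ) hv, rfl⟩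
  rwa [map_smul, norm_smul, norm_inv, norm_norm, inv_mul_eq_div,
    le_div_iff₀ (norm_pos_iff.2 hv)] at h

theorem conorm_pos [FiniteDimensional ℝ E] [Nontrivial E] {A : E →ₗ[ℝ] F}
    (hA : Function.Injective A) : 0 < conorm A := by
  have := FiniteDimensional.proper_real E
  have hcont : Continuous fun v ↦ ‖A v‖ := A.continuous_of_finiteDimensional.norm
  obtain ⟨v, hv, hv_eq⟩ := ((isCompact_sphere (0 : E) 1).image hcont).sInf_mem
    ((NormedSpace.sphere_nonempty.2 zero_le_one).image _)
  rw [conorm_eq_sInf_image_sphere, ← hv_eq]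
  exact norm_pos_iff.2 <| (map_ne_zero_iff A hA).2 <| ne_zero_of_mem_unit_sphere ⟨v, hv⟩

theorem conorm_eq_iInf_sphere (A : E →ₗ[ℝ] F) (e : V ≃ₗ[ℝ] E) :
    conorm A = ⨅ w : Metric.sphere (0 : V) 1, ‖A (e w)‖ / ‖e w‖ := by
  rw [conorm_eq_sInf_image_sphere, iInf]
  congr 1
  ext r
  constructor
  · rintro ⟨v, hv, rfl⟩
    have hv0 : e.symm v ≠ 0 := e.symm.map_ne_zero_iff.2 (ne_zero_of_mem_unit_sphere ⟨v, hv⟩)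
    refine ⟨⟨‖e.symm v‖⁻¹ • e.symm v, by simp [norm_smul, hv0]⟩, ?_⟩
    simp [norm_smul, mem_sphere_zero_iff_norm.1 hv, field]
  · rintro ⟨w, rfl⟩
    have hw0 : e w ≠ 0 := e.map_ne_zero_iff.2 (ne_zero_of_mem_unit_sphere w)
    refine ⟨‖e w‖⁻¹ • e w, by simp [norm_smul, hw0], ?_⟩
    simp [norm_smul, div_eq_inv_mul]

end Conorm

section RiemannianBundle

variable {B F : Type*} {E W : B → Type*} [TopologicalSpace B] [NormedAddCommGroup F]
  [NormedSpace ℝ F] [TopologicalSpace (TotalSpace F E)] [∀ x, NormedAddCommGroup (E x)]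
  [∀ x, InnerProductSpace ℝ (E x)] [FiberBundle F E] [VectorBundle ℝ F E]
  [IsContinuousRiemannianBundle F E] [∀ x, NormedAddCommGroup (W x)] [∀ x, NormedSpace ℝ (W x)]

variable (F E) in
theorem continuous_norm_totalSpace : Continuous fun p : TotalSpace F E ↦ ‖p.2‖ := by
  have h : Continuous fun p : TotalSpace F E ↦ inner ℝ p.2 p.2 :=
    Continuous.inner_bundle (F := F) (b := TotalSpace.proj) (v := TotalSpace.snd)
      (w := TotalSpace.snd) continuous_id continuous_id
  exact h.sqrt.congr fun p ↦ (norm_eq_sqrt_real_inner p.2).symm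

theorem continuous_conorm [ProperSpace F] {G : ∀ x, E x →ₗ[ℝ] W x}
    (hG : Continuous fun p : TotalSpace F E ↦ ‖G p.1 p.2‖) : Continuous fun x ↦ conorm (G x) := by
  refine continuous_iff_continuousAt.2 fun x₀ ↦ ?_
  set e := trivializationAt F E x₀
  let S := Metric.sphere (0 : F) 1
  let ψ (x : e.baseSet) : F ≃L[ℝ] E x := (e.continuousLinearEquivAt ℝ x x.2).symm
  have hψ : Continuous fun q : e.baseSet × S ↦ (⟨q.1, ψ q.1 q.2⟩ : TotalSpace F E) := by
    have hincl : Continuous fun q : e.baseSet × S ↦ ((q.1 : B), (q.2 : F)) := by fun_prop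
    refine (e.toOpenPartialHomeomorph.continuousOn_symm.comp_continuous hincl fun q ↦
      e.mem_target.2 q.1.2).congr fun q ↦ ?_
    exact e.symm_apply_eq_mk_continuousLinearEquivAt_symm _ q.1.2 _
  have hquot : Continuous fun q : e.baseSet × S ↦ ‖G q.1 (ψ q.1 q.2)‖ / ‖ψ q.1 q.2‖ :=
    (hG.comp hψ).div ((continuous_norm_totalSpace F E).comp hψ) fun q ↦
      norm_ne_zero_iff.2 <| (ψ q.1).map_ne_zero_iff.2 <| ne_zero_of_mem_unit_sphere q.2
  have hcont : ContinuousOn (fun x ↦ conorm (G x)) e.baseSet := by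
    rw [continuousOn_iff_continuous_domRestrict]
    refine (isCompact_univ.continuous_sInf (f := fun (x : e.baseSet) (w : S) ↦
      ‖G x (ψ x w)‖ / ‖ψ x w‖) hquot).congr fun x ↦ ?_
    rw [image_univ]
    exact (conorm_eq_iInf_sphere (G x) (ψ x).toLinearEquiv).symm
  exact hcont.continuousAt (e.open_baseSet.mem_nhds (FiberBundle.mem_baseSet_trivializationAt' x₀))

end RiemannianBundle

section DerivConorm

theorem norm_mfderiv_of_eventuallyEq_id {E H M : Type*} [NormedAddCommGroup E] [NormedSpace ℝ E]
    [TopologicalSpace H] {I : ModelWithCorners ℝ E H} [TopologicalSpace M] [ChartedSpace H M]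
    [RiemannianBundle (fun x : M ↦ TangentSpace I x)] {h : M → M} {w : M} (hh : h =ᶠ[𝓝 w] id)
    (u : TangentSpace I w) : ‖mfderiv I I h w u‖ = ‖u‖ := by
  -- `mfderiv I I h w u` and `u` agree in the model space `E`, but live over `h w` and over `w`
  have hnorm (a : M) (ha : a = w) (v : TangentSpace I a) (hv : v = (u : E)) : ‖v‖ = ‖u‖ := by
    subst ha hv
    rfl
  refine hnorm (h w) hh.eq_of_nhds _ ?_
  rw [hh.mfderiv_eq, mfderiv_id]
  rfl

variable {n : ℕ} {M : Type*} [TopologicalSpace M] [ChartedSpace (EuclideanSpace ℝ (Fin n)) M]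
  [RiemannianBundle (fun x : M ↦ TangentSpace (𝓡 n) x)]

theorem derivConorm_mul_norm_le (f : M → M) (x : M) (v : TangentSpace (𝓡 n) x) :
    derivConorm (n := n) f x * ‖v‖ ≤ ‖mfderiv (𝓡 n) (𝓡 n) f x v‖ :=
  conorm_mul_norm_le (mfderiv (𝓡 n) (𝓡 n) f x :
    TangentSpace (𝓡 n) x →ₗ[ℝ] TangentSpace (𝓡 n) (f x)) v

theorem derivConorm_pos (hn : 1 ≤ n) {f : M → M} (hf : IsLocalDiffeomorph (𝓡 n) (𝓡 n) 1 f)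
    (x : M) : 0 < derivConorm (n := n) f x := by
  have : Nonempty (Fin n) := ⟨⟨0, hn⟩⟩
  have : Nontrivial (TangentSpace (𝓡 n) x) :=
    inferInstanceAs (Nontrivial (EuclideanSpace ℝ (Fin n)))
  have : FiniteDimensional ℝ (TangentSpace (𝓡 n) x) :=
    inferInstanceAs (FiniteDimensional ℝ (EuclideanSpace ℝ (Fin n)))
  exact conorm_pos (hf.mfderivToContinuousLinearEquiv one_ne_zero x).injective

theorem enorm_mfderiv_le_of_one_le_mul_derivConorm {f g : M → M} {w : M}
    (hg : MDifferentiableAt (𝓡 n) (𝓡 n) g w) (hf : MDifferentiableAt (𝓡 n) (𝓡 n) f (g w))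
    (hfg : f ∘ g =ᶠ[𝓝 w] id) {C : ℝ≥0} (hC : 1 ≤ C * derivConorm (n := n) f (g w))
    (u : TangentSpace (𝓡 n) w) : ‖mfderiv (𝓡 n) (𝓡 n) g w u‖ₑ ≤ C * ‖u‖ₑ := by
  set v := mfderiv (𝓡 n) (𝓡 n) g w u
  have hnorm : ‖v‖ ≤ C * ‖u‖ :=
    calc ‖v‖ ≤ C * derivConorm (n := n) f (g w) * ‖v‖ :=
          le_mul_of_one_le_left (norm_nonneg v) hC
      _ = C * (derivConorm (n := n) f (g w) * ‖v‖) := mul_assoc _ _ _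
      _ ≤ C * ‖mfderiv (𝓡 n) (𝓡 n) f (g w) v‖ := by
          gcongr
          exact derivConorm_mul_norm_le f (g w) v
      _ = C * ‖mfderiv (𝓡 n) (𝓡 n) (f ∘ g) w u‖ := by rw [mfderiv_comp_apply w hf hg]
      _ = C * ‖u‖ := by rw [norm_mfderiv_of_eventuallyEq_id hfg u]
  exact ENNReal.coe_le_coe.2 (show ‖v‖₊ ≤ C * ‖u‖₊ from hnorm)

variable [IsManifold (𝓡 n) 1 M]
  [IsContinuousRiemannianBundle (EuclideanSpace ℝ (Fin n)) (fun x : M ↦ TangentSpace (𝓡 n) x)]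

theorem continuous_derivConorm {f : M → M} (hf : ContMDiff (𝓡 n) (𝓡 n) 1 f) :
    Continuous (derivConorm (n := n) f) :=
  continuous_conorm <| (continuous_norm_totalSpace _ _).comp (hf.continuous_tangentMap le_rfl)

theorem continuous_log_derivConorm (hn : 1 ≤ n) {f : M → M}
    (hf : IsLocalDiffeomorph (𝓡 n) (𝓡 n) 1 f) :
    Continuous fun x ↦ Real.log (derivConorm (n := n) f x) :=
  (continuous_derivConorm hf.contMDiff).log fun x ↦ (derivConorm_pos hn hf x).ne'

end DerivConorm

section RiemannianLipschitz

open Manifold MeasureTheory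

variable {E E' H H' M M' : Type*} [NormedAddCommGroup E] [NormedSpace ℝ E]
  [NormedAddCommGroup E'] [NormedSpace ℝ E'] [TopologicalSpace H] [TopologicalSpace H']
  {I : ModelWithCorners ℝ E H} {I' : ModelWithCorners ℝ E' H'} {C : ℝ≥0}

theorem pathELength_comp_le [TopologicalSpace M] [ChartedSpace H M]
    [RiemannianBundle (fun x : M ↦ TangentSpace I x)] [TopologicalSpace M'] [ChartedSpace H' M']
    [RiemannianBundle (fun x : M' ↦ TangentSpace I' x)] {g : M → M'} {γ : ℝ → M} {s : Set M}
    {a b : ℝ} (hg : ∀ w ∈ s, MDifferentiableAt I I' g w)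
    (hgC : ∀ w ∈ s, ∀ v : TangentSpace I w, ‖mfderiv I I' g w v‖ₑ ≤ C * ‖v‖ₑ)
    (hγ : ContMDiffOn 𝓘(ℝ) I 1 γ (Icc a b)) (hγs : MapsTo γ (Icc a b) s) :
    pathELength I' (g ∘ γ) a b ≤ C * pathELength I γ a b := by
  rw [pathELength_eq_lintegral_mfderiv_Ioo, pathELength_eq_lintegral_mfderiv_Ioo,
    ← lintegral_const_mul' _ _ ENNReal.coe_ne_top]
  refine setLIntegral_mono' measurableSet_Ioo fun t ht ↦ ?_
  have hγt : γ t ∈ s := hγs (Ioo_subset_Icc_self ht)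
  rw [mfderiv_comp_apply t (hg _ hγt)
    ((hγ.contMDiffAt (Icc_mem_nhds ht.1 ht.2)).mdifferentiableAt one_ne_zero)]
  exact hgC _ hγt _

variable [PseudoEMetricSpace M] [ChartedSpace H M]
  [RiemannianBundle (fun x : M ↦ TangentSpace I x)] [IsRiemannianManifold I M]
  [PseudoEMetricSpace M'] [ChartedSpace H' M']
  [RiemannianBundle (fun x : M' ↦ TangentSpace I' x)] [IsRiemannianManifold I' M']

theorem edist_le_pathELength {γ : ℝ → M} {a b : ℝ} (hγ : ContMDiffOn 𝓘(ℝ) I 1 γ (Icc a b))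
    (hab : a ≤ b) : edist (γ a) (γ b) ≤ pathELength I γ a b := by
  rw [IsRiemannianManifold.out (I := I) (γ a) (γ b)]
  exact riemannianEDist_le_pathELength hγ rfl rfl hab

theorem mapsTo_eball_of_pathELength_lt {γ : ℝ → M} {a b : ℝ} {R : ℝ≥0∞}
    (hγ : ContMDiffOn 𝓘(ℝ) I 1 γ (Icc a b)) (hR : pathELength I γ a b < R) :
    MapsTo γ (Icc a b) (Metric.eball (γ a) R) := fun t ht ↦ by
  rw [Metric.mem_eball']
  calc edist (γ a) (γ t) ≤ pathELength I γ a t :=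
        edist_le_pathELength (hγ.mono (Icc_subset_Icc_right ht.2)) ht.1
    _ ≤ pathELength I γ a b := pathELength_mono le_rfl ht.2
    _ < R := hR

theorem lipschitzOnWith_eball_of_enorm_mfderiv_le {g : M → M'} {c : M} {R : ℝ≥0∞}
    (hg : ContMDiffOn I I' 1 g (Metric.eball c (3 * R)))
    (hgC : ∀ w ∈ Metric.eball c (3 * R), ∀ v : TangentSpace I w,
      ‖mfderiv I I' g w v‖ₑ ≤ C * ‖v‖ₑ) :
    LipschitzOnWith C g (Metric.eball c R) := fun y hy z hz ↦ by
  have hyz : edist y z < 2 * R := by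
    rw [two_mul]
    exact (edist_triangle_right y z c).trans_lt (ENNReal.add_lt_add hy hz)
  have hball : Metric.eball y (2 * R) ⊆ Metric.eball c (3 * R) := fun w hw ↦ by
    rw [Metric.mem_eball, (by ring : (3 : ℝ≥0∞) * R = 2 * R + R)]
    exact (edist_triangle w y c).trans_lt (ENNReal.add_lt_add hw hy)
  have hle : ∀ L ∈ Ioo (edist y z) (2 * R), edist (g y) (g z) ≤ C * L := fun L hL ↦ by
    obtain ⟨γ, rfl, rfl, hγ, hγL⟩ := exists_lt_of_riemannianEDist_lt <|
      (IsRiemannianManifold.out (I := I) y z).symm.trans_lt hL.1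
    have hγ_mem := (mapsTo_eball_of_pathELength_lt hγ (hγL.trans hL.2)).mono_right hball
    calc edist (g (γ 0)) (g (γ 1)) ≤ pathELength I' (g ∘ γ) 0 1 :=
          edist_le_pathELength (hg.comp hγ hγ_mem) zero_le_one
      _ ≤ C * pathELength I γ 0 1 :=
          pathELength_comp_le (fun w hw ↦ (hg.contMDiffAt
            (Metric.isOpen_eball.mem_nhds hw)).mdifferentiableAt one_ne_zero) hgC hγ hγ_mem
      _ ≤ C * L := by gcongr
  have := nhdsGT_neBot_of_exists_gt ⟨_, hyz⟩
  have hlim : Tendsto (fun L : ℝ≥0∞ ↦ C * L) (𝓝[>] (edist y z)) (𝓝 (C * edist y z)) :=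
    (ENNReal.continuous_const_mul ENNReal.coe_ne_top).continuousAt.mono_left nhdsWithin_le_nhds
  exact ge_of_tendsto hlim <| eventually_of_mem (Ioo_mem_nhdsGT hyz) hle

theorem exists_mem_nhds_lipschitzOnWith_of_enorm_mfderiv_le {g : M → M'} {c : M} {s : Set M}
    (hs : s ∈ 𝓝 c) (hg : ContMDiffOn I I' 1 g s)
    (hgC : ∀ w ∈ s, ∀ v : TangentSpace I w, ‖mfderiv I I' g w v‖ₑ ≤ C * ‖v‖ₑ) :
    ∃ t ∈ 𝓝 c, LipschitzOnWith C g t := by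
  obtain ⟨ρ, hρ, hρs⟩ := Metric.nhds_basis_eball.mem_iff.1 hs
  have h3ρ : 3 * (ρ / 3) = ρ := ENNReal.mul_div_cancel (by simp) (by simp)
  rw [← h3ρ] at hρs
  exact ⟨_, Metric.eball_mem_nhds c (ENNReal.div_pos hρ.ne' (by simp)),
    lipschitzOnWith_eball_of_enorm_mfderiv_le (hg.mono hρs) fun w hw ↦ hgC w (hρs hw)⟩

end RiemannianLipschitz

section InverseBranchesOfLocalDiffeomorph

variable {n : ℕ} {M : Type*} [EMetricSpace M] [ChartedSpace (EuclideanSpace ℝ (Fin n)) M]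
  [RiemannianBundle (fun x : M ↦ TangentSpace (𝓡 n) x)] [IsManifold (𝓡 n) 1 M]
  [IsRiemannianManifold (𝓡 n) M]
  [IsContinuousRiemannianBundle (EuclideanSpace ℝ (Fin n)) (fun x : M ↦ TangentSpace (𝓡 n) x)]
  {f : M → M}

theorem exists_eventually_isInverseBranchAt_of_one_lt_mul_derivConorm
    (hf : IsLocalDiffeomorph (𝓡 n) (𝓡 n) 1 f) {x₀ : M} {C : ℝ≥0}
    (hC : 1 < C * derivConorm (n := n) f x₀) :
    ∃ r > 0, ∃ g, ∀ᶠ x in 𝓝 x₀, IsInverseBranchAt f x r C g := by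
  obtain ⟨Φ, hx₀, hfΦ⟩ := hf x₀
  set e := Φ.toOpenPartialHomeomorph
  have hsymm_f : ∀ x ∈ e.source, e.symm (f x) = x := fun x hx ↦
    (congrArg e.symm (hfΦ hx)).trans (e.left_inv hx)
  have hf_symm : RightInvOn e.symm f e.target := fun y hy ↦
    (hfΦ (e.map_target hy)).trans (e.right_inv hy)
  have htarget : e.target ∈ 𝓝 (f x₀) := by
    rw [hfΦ hx₀]
    exact e.open_target.mem_nhds (e.map_source hx₀)
  have hsmooth : ContMDiffOn (𝓡 n) (𝓡 n) 1 e.symm e.target := Φ.contMDiffOn_invFun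
  have hexpand : ∀ᶠ w in 𝓝 (f x₀), 1 < C * derivConorm (n := n) f (e.symm w) := by
    have hlim : Tendsto e.symm (𝓝 (f x₀)) (𝓝 x₀) := by
      simpa only [ContinuousAt, hsymm_f x₀ hx₀] using hsmooth.continuousOn.continuousAt htarget
    exact hlim.eventually <| continuousAt_const.eventually_lt
      (continuousAt_const.mul (continuous_derivConorm hf.contMDiff).continuousAt) hC
  have hbound : ∀ w ∈ e.target ∩ {w | 1 < C * derivConorm (n := n) f (e.symm w)},
      ∀ u : TangentSpace (𝓡 n) w, ‖mfderiv (𝓡 n) (𝓡 n) e.symm w u‖ₑ ≤ C * ‖u‖ₑ := by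
    rintro w ⟨hw, hwC⟩ u
    have hw_nhds : e.target ∈ 𝓝 w := e.open_target.mem_nhds hw
    exact enorm_mfderiv_le_of_one_le_mul_derivConorm
      ((hsmooth.contMDiffAt hw_nhds).mdifferentiableAt one_ne_zero)
      ((hf (e.symm w)).mdifferentiableAt one_ne_zero) (eventuallyEq_of_mem hw_nhds hf_symm)
      hwC.le u
  obtain ⟨t, ht, hLip⟩ := exists_mem_nhds_lipschitzOnWith_of_enorm_mfderiv_le
    (inter_mem htarget hexpand) (hsmooth.mono inter_subset_left) hbound
  obtain ⟨r, hr, hr_branch⟩ := exists_eventually_isInverseBranchAt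
    hf.contMDiff.continuous.continuousAt (eventually_of_mem (e.open_source.mem_nhds hx₀) hsymm_f)
    (inter_mem htarget ht) (hf_symm.mono inter_subset_left) (hLip.mono inter_subset_right)
  exact ⟨r, hr, e.symm, hr_branch⟩

theorem exists_hasInverseBranches_of_one_lt_mul_derivConorm [CompactSpace M]
    (hf : IsLocalDiffeomorph (𝓡 n) (𝓡 n) 1 f) {K : M → ℝ≥0} (hK : Continuous K)
    (hKf : ∀ x, 1 < K x * derivConorm (n := n) f x) : ∃ r > 0, HasInverseBranches f r K := by
  refine exists_hasInverseBranches_of_locally fun x₀ ↦ ?_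
  have hpos : 0 < derivConorm (n := n) f x₀ :=
    pos_of_mul_pos_right (one_pos.trans (hKf x₀)) (K x₀).coe_nonneg
  obtain ⟨C, hC, hCK⟩ := exists_between ((inv_lt_iff_one_lt_mul₀ hpos).2 (hKf x₀))
  lift C to ℝ≥0 using (inv_pos.2 hpos).le.trans hC.le
  rw [inv_lt_iff_one_lt_mul₀ hpos] at hC
  obtain ⟨r, hr, g, hg⟩ := exists_eventually_isInverseBranchAt_of_one_lt_mul_derivConorm hf hC
  refine ⟨r, hr, ?_⟩
  filter_upwards [hg, hK.continuousAt.eventually_const_lt (NNReal.coe_lt_coe.1 hCK)] with x hx hCx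
  exact ⟨g, hx.mono le_rfl hCx.le⟩

theorem exists_hasInverseBranches_mul_exp_sub_log [CompactSpace M] (hn : 1 ≤ n)
    (hf : IsLocalDiffeomorph (𝓡 n) (𝓡 n) 1 f) {lam : ℝ} {θ : ℝ≥0} (hθ : Real.exp (-lam) < θ) :
    ∃ r > 0, HasInverseBranches f r fun x ↦
      θ * (Real.exp (-(Real.log (derivConorm (n := n) f x) - lam))).toNNReal := by
  have hcont := continuous_log_derivConorm hn hf
  refine exists_hasInverseBranches_of_one_lt_mul_derivConorm hf (by fun_prop) fun x ↦ ?_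
  have hpos := derivConorm_pos hn hf x
  have hexp : Real.exp (-(Real.log (derivConorm (n := n) f x) - lam)) * derivConorm (n := n) f x =
      Real.exp lam := by
    nth_rw 2 [← Real.exp_log hpos]
    rw [← Real.exp_add]
    ring_nf
  rw [NNReal.coe_mul, Real.coe_toNNReal _ (Real.exp_pos _).le, mul_assoc, hexp]
  calc 1 = Real.exp (-lam) * Real.exp lam := by rw [← Real.exp_add, neg_add_cancel, Real.exp_zero]
    _ < θ * Real.exp lam := by gcongr

end InverseBranchesOfLocalDiffeomorph

section ClosingLemma

theorem HasInverseBranches.exists_isPeriodicPt_of_nonnegTailSums {X : Type*} [EMetricSpace X]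
    [CompleteSpace X] {f : X → X} {ψ : X → ℝ} {x : ℕ → X} {len : ℕ → ℕ} {k : ℕ} {r : ℝ≥0∞}
    {θ : ℝ≥0} (hf : HasInverseBranches f r fun y ↦ θ * (Real.exp (-ψ y)).toNNReal) (hr : r ≠ ⊤)
    (hθ : θ < 1) (hlen : ∀ i ≤ k, 1 ≤ len i)
    (hψ : ∀ i ≤ k, NonnegTailSums (fun t ↦ ψ (f^[t] (x i))) (len i)) (hx : x (k + 1) = x 0)
    (hjump : ∀ i ≤ k, edist (f^[len i] (x i)) (x (i + 1)) ≤ (1 - θ) * r) :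
    ∃ p, Function.IsPeriodicPt f (∑ i ∈ Finset.range (k + 1), len i) p ∧
      ∀ i ≤ k, ∀ j ≤ len i,
        edist (f^[(∑ m ∈ Finset.range i, len m) + j] p) (f^[j] (x i)) ≤ r := by
  have hδ : θ * r + (1 - θ) * r ≤ r := by
    rw [← add_mul, add_tsub_cancel_of_le (by exact_mod_cast hθ.le), one_mul]
  refine hf.exists_isPeriodicPt_shadowing hr hθ hδ (fun i hi a ↦ ?_) (fun i hi ↦ ?_) hx hjump
  · exact ((hψ i hi).prod_mul_exp_neg_le θ a).trans (pow_le_one' hθ.le _)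
  · rw [Finset.range_eq_Ico]
    exact ((hψ i hi).prod_mul_exp_neg_le θ 0).trans
      (pow_le_of_le_one zero_le hθ.le (Nat.one_le_iff_ne_zero.1 (hlen i hi)))

theorem exists_isPeriodicPt_shadowing_of_isLocalDiffeomorph {n : ℕ} (hn : 1 ≤ n) {M : Type*}
    [TopologicalSpace M] [T3Space M] [CompactSpace M] [ChartedSpace (EuclideanSpace ℝ (Fin n)) M]
    [RiemannianBundle (fun x : M ↦ TangentSpace (𝓡 n) x)] [IsManifold (𝓡 n) 1 M]
    [IsContinuousRiemannianBundle (EuclideanSpace ℝ (Fin n)) (fun x : M ↦ TangentSpace (𝓡 n) x)]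
    {f : M → M} (hf : IsLocalDiffeomorph (𝓡 n) (𝓡 n) 1 f) {lam : ℝ} (hlam : 0 < lam)
    {U : Set (M × M)} (hU : U ∈ 𝓝ˢ (diagonal M)) :
    ∃ V ∈ 𝓝ˢ (diagonal M), ∀ (k : ℕ) (x : ℕ → M) (len : ℕ → ℕ),
      (∀ i ≤ k, 1 ≤ len i) →
      (∀ i ≤ k, NonnegTailSums
        (fun t ↦ Real.log (derivConorm (n := n) f (f^[t] (x i))) - lam) (len i)) →
      x (k + 1) = x 0 → (∀ i ≤ k, (f^[len i] (x i), x (i + 1)) ∈ V) →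
      ∃ p, Function.IsPeriodicPt f (∑ m ∈ Finset.range (k + 1), len m) p ∧
        ∀ i ≤ k, ∀ j ≤ len i, (f^[(∑ m ∈ Finset.range i, len m) + j] p, f^[j] (x i)) ∈ U := by
  let : EMetricSpace M := .ofRiemannianMetric (𝓡 n) M
  have : IsRiemannianManifold (𝓡 n) M := ⟨fun _ _ ↦ rfl⟩
  rw [nhdsSet_diagonal_eq_uniformity] at hU ⊢
  obtain ⟨θ, hlamθ, hθ⟩ := exists_between (Real.exp_lt_one_iff.2 (neg_lt_zero.2 hlam))
  lift θ to ℝ≥0 using (Real.exp_pos _).le.trans hlamθ.le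
  obtain ⟨r₁, hr₁, hf_branches⟩ := exists_hasInverseBranches_mul_exp_sub_log hn hf hlamθ
  obtain ⟨r₀, hr₀, hrU⟩ := mem_uniformity_edist.1 hU
  obtain ⟨r, hr, hr_lt⟩ := exists_between (lt_min hr₀ hr₁)
  have hδ : 0 < (1 - θ : ℝ≥0∞) * r :=
    ENNReal.mul_pos (tsub_pos_of_lt (by exact_mod_cast hθ)).ne' hr.ne'
  refine ⟨_, edist_mem_uniformity hδ, fun k x len hlen hx hclosed hV ↦ ?_⟩
  obtain ⟨p, hp, hp_shadow⟩ :=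
    (hf_branches.mono (hr_lt.le.trans (min_le_right _ _))).exists_isPeriodicPt_of_nonnegTailSums
      hr_lt.ne_top hθ hlen hx hclosed fun i hi ↦ (hV i hi).le
  exact ⟨p, hp, fun i hi j hj ↦
    hrU ((hp_shadow i hi j hj).trans_lt (hr_lt.trans_le (min_le_left _ _)))⟩

end ClosingLemma

section MainTheorem

theorem sum_Icc_sub_eq_sum_Ico {u : ℕ → ℝ} {k ℓ : ℕ} (hℓ : ℓ ≤ k) :
    ∑ j ∈ Finset.Icc 1 ℓ, u (k - j) = ∑ t ∈ Finset.Ico (k - ℓ) k, u t := by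
  refine Finset.sum_bij' (fun j _ ↦ k - j) (fun t _ ↦ k - t) ?_ ?_ ?_ ?_ ?_ <;> grind

theorem nonnegTailSums_sub_const_iff {u : ℕ → ℝ} {c : ℝ} {k : ℕ} :
    NonnegTailSums (fun t ↦ u t - c) k ↔
      ∀ ℓ : ℕ, 1 ≤ ℓ → ℓ ≤ k → c ≤ 1 / (ℓ : ℝ) * ∑ j ∈ Finset.Icc 1 ℓ, u (k - j) := by
  have htail {ℓ : ℕ} (hℓ : 1 ≤ ℓ) (hℓk : ℓ ≤ k) :
      0 ≤ ∑ t ∈ Finset.Ico (k - ℓ) k, (u t - c) ↔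
        c ≤ 1 / (ℓ : ℝ) * ∑ j ∈ Finset.Icc 1 ℓ, u (k - j) := by
    have hℓ_pos : (0 : ℝ) < ℓ := by exact_mod_cast hℓ
    rw [one_div_mul_eq_div, le_div_iff₀ hℓ_pos, sum_Icc_sub_eq_sum_Ico hℓk,
      Finset.sum_sub_distrib, Finset.sum_const, Nat.card_Ico, Nat.sub_sub_self hℓk, nsmul_eq_mul,
      sub_nonneg, mul_comm]
  refine ⟨fun h ℓ hℓ hℓk ↦ (htail hℓ hℓk).1 (h (k - ℓ)), fun h a ↦ ?_⟩
  rcases le_or_gt k a with hka | hak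
  · simp [Finset.Ico_eq_empty_of_le hka]
  · have := (htail (ℓ := k - a) (by lia) (by lia)).2 (h (k - a) (by lia) (by lia))
    rwa [Nat.sub_sub_self hak.le] at this

theorem isContinuousRiemannianBundle_of_isContMDiffRiemannianBundle {EB HB F B : Type*}
    {E : B → Type*} [NormedAddCommGroup EB] [NormedSpace ℝ EB] [TopologicalSpace HB]
    {IB : ModelWithCorners ℝ EB HB} [TopologicalSpace B] [ChartedSpace HB B]
    [NormedAddCommGroup F] [NormedSpace ℝ F] [TopologicalSpace (TotalSpace F E)]
    [∀ x, NormedAddCommGroup (E x)] [∀ x, InnerProductSpace ℝ (E x)] [FiberBundle F E]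
    [VectorBundle ℝ F E] {m : ℕ∞ω} [h : IsContMDiffRiemannianBundle IB m F E] :
    IsContinuousRiemannianBundle F E := by
  obtain ⟨g, hg, h⟩ := h.exists_contMDiff
  exact ⟨g, hg.continuous, h⟩

theorem theorem2p1_general {n : ℕ} (hn : 1 ≤ n) {M : Type*} [MetricSpace M] [CompactSpace M]
    [ChartedSpace (EuclideanSpace ℝ (Fin n)) M] [IsManifold (𝓡 n) 1 M]
    [RiemannianBundle (fun x : M ↦ TangentSpace (𝓡 n) x)]
    [IsContinuousRiemannianBundle (EuclideanSpace ℝ (Fin n)) (fun x : M ↦ TangentSpace (𝓡 n) x)]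
    {f : M → M} (hf : IsLocalDiffeomorph (𝓡 n) (𝓡 n) 1 f)
    {ε lam : ℝ} (hε : 0 < ε) (hlam : 0 < lam) :
    ∃ δ : ℝ, 0 < δ ∧
      ∀ (k : ℕ) (x : ℕ → M) (len : ℕ → ℕ),
        (∀ i ≤ k, IsQuasiExpandingString (n := n) f lam (x i) (len i)) →
        x (k + 1) = x 0 →
        (∀ i ≤ k, dist (f^[len i] (x i)) (x (i + 1)) < δ) →
        ∃ (p : M) (τ : ℕ), τ = ∑ i ∈ Finset.range (k + 1), len i ∧ 0 < τ ∧
          Function.IsPeriodicPt f τ p ∧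
          (∀ i ≤ k, ∀ j ≤ len i,
            dist (f^[(∑ m ∈ Finset.range i, len m) + j] p) (f^[j] (x i)) < ε) ∧
          (∀ ℓ : ℕ, 1 ≤ ℓ → ℓ ≤ τ → lam - ε ≤ backwardAverage (n := n) f p τ ℓ) := by
  set φ : M → ℝ := fun x ↦ Real.log (derivConorm (n := n) f x)
  have hφ : Continuous φ := continuous_log_derivConorm hn hf
  let U : Set (M × M) := {q | dist q.1 q.2 < ε} ∩ {q | dist (φ q.1) (φ q.2) < ε}
  have hU : U ∈ 𝓝ˢ (diagonal M) := by
    refine ((isOpen_lt (by fun_prop) continuous_const).inter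
      (isOpen_lt (by fun_prop) continuous_const)).mem_nhdsSet.2 ?_
    rintro ⟨a, b⟩ hab
    obtain rfl : a = b := hab
    simp [hε]
  obtain ⟨V, hV, hshadow⟩ := exists_isPeriodicPt_shadowing_of_isLocalDiffeomorph hn hf hlam hU
  rw [nhdsSet_diagonal_eq_uniformity] at hV
  obtain ⟨δ, hδ, hδV⟩ := Metric.mem_uniformity_dist.1 hV
  refine ⟨δ, hδ, fun k x len hx hclosed hjump ↦ ?_⟩
  have hx_tails (i : ℕ) (hi : i ≤ k) : NonnegTailSums (fun t ↦ φ (f^[t] (x i)) - lam) (len i) :=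
    nonnegTailSums_sub_const_iff (u := fun t ↦ φ (f^[t] (x i))) |>.2 (hx i hi).2
  obtain ⟨p, hp, hp_shadow⟩ := hshadow k x len (fun i hi ↦ (hx i hi).1) hx_tails hclosed
    fun i hi ↦ hδV (hjump i hi)
  have hp_tails : NonnegTailSums (fun t ↦ φ (f^[t] p) - (lam - ε))
      (∑ i ∈ Finset.range (k + 1), len i) := by
    refine .concat _ fun i hi ↦ (hx_tails i (Nat.le_of_lt_succ hi)).mono fun t ht ↦ ?_
    have hclose : dist (φ (f^[(∑ m ∈ Finset.range i, len m) + t] p)) (φ (f^[t] (x i))) < ε :=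
      (hp_shadow i (Nat.le_of_lt_succ hi) t ht.le).2
    linarith [(abs_lt.1 (Real.dist_eq _ _ ▸ hclose)).1]
  refine ⟨p, _, rfl, ?_, hp, fun i hi j hj ↦ (hp_shadow i hi j hj).1,
    nonnegTailSums_sub_const_iff.1 hp_tails⟩
  exact Finset.sum_pos (fun i hi ↦ (hx i (Finset.mem_range_succ_iff.1 hi)).1) (by simp)

end MainTheorem

theorem theorem2p1 {n : ℕ} (hn : 1 ≤ n)
    {M : Type*} [MetricSpace M] [CompactSpace M]
    [ChartedSpace (EuclideanSpace ℝ (Fin n)) M] [IsManifold (𝓡 n) ∞ M]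
    [Bundle.RiemannianBundle (fun x : M ↦ TangentSpace (𝓡 n) x)]
    [IsContMDiffRiemannianBundle (𝓡 n) ∞ (EuclideanSpace ℝ (Fin n))
      (fun x : M ↦ TangentSpace (𝓡 n) x)]
    (f : M → M) (hf : IsC1LocalDiffeo (n := n) f)
    (ε lam : ℝ) (hε : 0 < ε) (hlam : 0 < lam) :
    ∃ δ : ℝ, 0 < δ ∧
      ∀ (k : ℕ) (x : ℕ → M) (len : ℕ → ℕ),
        (∀ i ≤ k, IsQuasiExpandingString (n := n) f lam (x i) (len i)) →
        x (k + 1) = x 0 →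
        (∀ i ≤ k, dist (f^[len i] (x i)) (x (i + 1)) < δ) →
        ∃ (p : M) (τ : ℕ), τ = ∑ i ∈ Finset.range (k + 1), len i ∧ 0 < τ ∧
          Function.IsPeriodicPt f τ p ∧
          (∀ i ≤ k, ∀ j ≤ len i,
            dist (f^[(∑ m ∈ Finset.range i, len m) + j] p) (f^[j] (x i)) < ε) ∧
          (∀ ℓ : ℕ, 1 ≤ ℓ → ℓ ≤ τ → lam - ε ≤ backwardAverage (n := n) f p τ ℓ) := by
  have : IsManifold (𝓡 n) 1 M := .of_le (n := ∞) (by simp)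
  have := isContinuousRiemannianBundle_of_isContMDiffRiemannianBundle (IB := 𝓡 n) (m := ∞)
    (F := EuclideanSpace ℝ (Fin n)) (E := fun x : M ↦ TangentSpace (𝓡 n) x)
  exact theorem2p1_general hn hf.2 hε hlam
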